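/- **Minimax lower bound under the correlated noise model.** Let $\beta>0$, $L>0$ and $\sigma^2>0$. Let $\Sigma(\beta,L)$ be the Hölder class on $[0,1]$: with $\ell$ the largest integer strictly smaller than $\beta$, it consists of the $\ell$ times differentiable functions $f$ on $[0,1]$ with $|f^{(\ell)}(x)-f^{(\ell)}(x')|\le L|x-x'|^{\beta-\ell}$ for all $x,x'\in[0,1]$. For an integer $B\ge 1$, split $[0,1]$ into the $B$ buckets $[\frac{b-1}{B},\frac{b}{B})$, $b=1,\dots,B$ (with the point $1$ put into the last one), and let $b(x)$ be the bucket of $x$. For $\delta\ge 0$ let $\Xi$ be the law of $\xi=(\xi_1,\dots,\xi_B)$ with independent $\xi_b\sim N(0,\delta^2\sigma^2)$. For a regression function $f$ and a realization $\xi$, let $P_{\xi,f}$ be the law of $(X,Y)$, where $X\sim\mathrm{Unif}[0,1]$ and $Y=f(X)+e+\xi_{b(X)}$ with $e\sim N(0,\sigma^2)$ independent of $X$. A sample of size $n$ is generated by first drawing $\xi\sim\Xi$ and then drawing $(X_1,Y_1),\dots,(X_n,Y_n)$ independently from $P_{\xi,f}$; $\mathbb{E}_\Xi$ and $\mathbb{E}^n_{\xi,f}$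 denote the corresponding expectations. The perturbation strength is $\tau=\delta^2\bar\rho$, where $\bar\rho=\mathbb{P}(b(X)=b(X'))$ for independent $X,X'\sim\mathrm{Unif}[0,1]$ (that is, $\tau=\delta^2/B$). Then there is a constant $c_1>0$, depending only on $\sigma^2$, $\beta$ and $L$, such that the following holds. Let $x_0\in[0,1]$, and for each $n$ let $B=B_X(n)\ge 1$ be an integer and $\delta=\delta_n\ge 0$, with strength $\tau_n$, such that the sequences $n/B_X(n)$ and $n\tau_n$ are bounded (in particular, this is so if both have finite limits). Put $n_{\mathrm{eff}}=n/(1+n\tau_n)$. Then $$\liminf_{n\to\infty}\ \inf_{\hat f_n}\ \sup_{f\in\Sigma(\beta,L)}\ \mathbb{E}_\Xi\,\mathbb{E}^n_{\xi,f}\Big[n_{\mathrm{eff}}^{\frac{2\beta}{2\beta+1}}\big(\hat f_n(x_0)-f(x_0)\big)^2\Big]\ \ge\ c_1,$$ where the infimum is over all estimators $\hat f_n(x_0)$ of $f(x_0)$, i.e. all measurable functions of the data $(X_1,Y_1),\dots,(X_n,Y_n)$. -/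

import Mathlib

open MeasureTheory ProbabilityTheory Filter Set
open scoped NNReal ENNReal

noncomputable section

namespace RUP

/-- The largest integer strictly smaller than `β` (for `β > 0`). -/
def holderOrder (β : ℝ) : ℕ := ⌈β⌉₊ - 1

/-- The Hölder class `Σ(β, L)` on `[0,1]`: the `ℓ`-th derivative, `ℓ` the largest integer strictly
smaller than `β`, exists on `[0,1]` (one-sided at the endpoints) and is `(β - ℓ)`-Hölder there with
constant `L`. Only the values of `f` on `[0,1]` matter. -/
def holderClass (β L : ℝ) : Set (ℝ → ℝ) :=
  {f | ContDiffOn ℝ (holderOrder β) f (Icc 0 1) ∧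
    ∀ x ∈ Icc (0 : ℝ) 1, ∀ x' ∈ Icc (0 : ℝ) 1,
      |iteratedDerivWithin (holderOrder β) f (Icc 0 1) x
          - iteratedDerivWithin (holderOrder β) f (Icc 0 1) x'|
        ≤ L * |x - x'| ^ (β - holderOrder β)}

/-- The covariate law, uniform on `[0,1]`. -/
def covariateLaw : Measure ℝ := volume.restrict (Icc 0 1)

/-- The bucket of a covariate `x ∈ [0,1]`: the index `b` with `x ∈ [b / B, (b + 1) / B)`
(buckets are numbered from `0`; the point `x = 1` is put into the last one). -/
def bucket (B : ℕ+) (x : ℝ) : Fin B :=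
  ⟨min ⌊(B : ℝ) * x⌋₊ ((B : ℕ) - 1), by have := B.pos; omega⟩

/-- The law `Ξ` of the perturbation index: independent shifts `ξ_b ∼ N(0, δ² σ²)`, one for each
bucket. -/
def perturbationLaw (σ δ : ℝ≥0) (B : ℕ+) : Measure (Fin B → ℝ) :=
  Measure.pi fun _ => gaussianReal 0 (δ ^ 2 * σ ^ 2)

/-- The perturbed law `P_ξ` of one observation `(X, Y)` with regression function `f`:
`X` is uniform on `[0,1]`, independent of the baseline noise `e ∼ N(0, σ²)`, and
`Y = f(X) + e + ξ_{b(X)}`. -/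
def perturbedLaw (σ : ℝ≥0) (B : ℕ+) (f : ℝ → ℝ) (ξ : Fin B → ℝ) : Measure (ℝ × ℝ) :=
  (covariateLaw.prod (gaussianReal 0 (σ ^ 2))).map
    fun p => (p.1, f p.1 + (p.2 + ξ (bucket B p.1)))

/-- The correlation kernel `ρ` of the correlated noise model. -/
def corrKernel (B : ℕ+) (x x' : ℝ) : ℝ := if bucket B x = bucket B x' then 1 else 0

/-- The average correlation `E[ρ(X₁, X₂)]` over independent covariates `X₁`, `X₂`. -/
def avgCorr (B : ℕ+) : ℝ := ∫ x, ∫ x', corrKernel B x x' ∂covariateLaw ∂covariateLaw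

/-- The perturbation strength `τ = δ² * E[ρ(X₁, X₂)]`. -/
def strength (δ : ℝ≥0) (B : ℕ+) : ℝ := (δ : ℝ) ^ 2 * avgCorr B

/-- The effective sample size `n / (1 + n τ)`. -/
def effSampleSize (n : ℕ) (τ : ℝ) : ℝ := n / (1 + n * τ)

/-- `E_Ξ E_{ξ,f}^n [r * (g - f(x₀))²]` for an estimator `g` of `f(x₀)`: first `ξ` is drawn from
`Ξ`, then `n` observations are drawn independently from `P_ξ`. -/
def scaledRisk (σ δ : ℝ≥0) (B : ℕ+) (n : ℕ) (r x₀ : ℝ) (g : (Fin n → ℝ × ℝ) → ℝ) (f : ℝ → ℝ) :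
    ℝ≥0∞ :=
  ∫⁻ ξ, ∫⁻ D, ENNReal.ofReal (r * (g D - f x₀) ^ 2)
    ∂(Measure.pi fun _ : Fin n => perturbedLaw σ B f ξ) ∂(perturbationLaw σ δ B)

/-- The minimax risk at `x₀` over `Σ(β, L)`, rescaled by `n_eff ^ (2β / (2β + 1))`; the infimum is
over all estimators, that is, all measurable functions of the `n` observations. -/
def minimaxScaledRisk (β L : ℝ) (σ δ : ℝ≥0) (B : ℕ+) (x₀ : ℝ) (n : ℕ) : ℝ≥0∞ :=
  ⨅ g : {g : (Fin n → ℝ × ℝ) → ℝ // Measurable g}, ⨆ f ∈ holderClass β L,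
    scaledRisk σ δ B n (effSampleSize n (strength δ B) ^ (2 * β / (2 * β + 1))) x₀ g.1 f

end RUP

end

namespace RUP

/-! This is a two-point argument: the regression functions `0` and `f = a h^β φ((x - x₀) / h)`
differ at `x₀` by `a h^β`, yet the data cannot tell them apart reliably when `n_eff h^(2β+1) = 1`.

The comparison takes place on the latent space of bucket shifts, covariates and noise. Data
generated with `f` are data generated with `0` after moving each bucket shift by `m_b` and each
noise variable by `f(X) - m_{b(X)}`, for any choice of `m`. The likelihood ratio of this translation
is an explicit product of Gaussian ratios (`latentLaw_map_shift`). If its second moment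
(`lintegral_latentRatio_sq`) is at most 2, the two risks cannot both be small (`two_point_bound`).

Take `m_b = λ f(b/B)`. Up to constants and the variation of `f` within a bucket, the exponent of the
second moment is `a² h^(2β+1) (λ²/τ + n (1 - λ)²) / σ²`. It is minimised at `λ = nτ / (1 + nτ)`,
with value `a² h^(2β+1) n_eff / σ²`; this is where the effective sample size comes from.
`exp_sum_mul_lintegral_pow_le` makes this precise, and `exists_holder_bump` supplies `φ`.
Boundedness of `n/B` and `nτ` makes `B h` tend to infinity, so the within-bucket variation is
eventually negligible. -/

/-! ### Two-point inequality from a second-moment bound -/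

/-- Integrate `s D ≤ (A + A') min(1, D) + s D²/4`: the last term costs at most `s/2`. Here `A` and
`A'` play the losses at the two points and `D` the likelihood ratio. -/
theorem half_le_lintegral_add_lintegral_mul {Ω : Type*} [MeasurableSpace Ω] {ν : Measure Ω}
    {A A' D : Ω → ℝ≥0∞} {s : ℝ≥0∞} (hA : Measurable A) (hA' : Measurable A') (hD : Measurable D)
    (hs : s ≠ ∞) (hsA : ∀ z, s ≤ A z + A' z) (hD1 : ∫⁻ z, D z ∂ν = 1)
    (hD2 : ∫⁻ z, D z ^ 2 ∂ν ≤ 2) :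
    s / 2 ≤ ∫⁻ z, A z ∂ν + ∫⁻ z, D z * A' z ∂ν := by
  -- For `d ≥ 1` this is `(d/2 - 1)² ≥ 0`.
  have hmin : ∀ d : ℝ≥0∞, d ≤ min 1 d + d ^ 2 / 4 := by
    intro d
    rcases le_total d 1 with h | h
    · rw [min_eq_right h]; exact le_self_add
    · rw [min_eq_left h]
      rcases eq_or_ne d ∞ with rfl | hd
      · simp [ENNReal.top_div]
      · lift d to ℝ≥0 using hd
        have : d ≤ 1 + d ^ 2 / 4 := by
          rw [← NNReal.coe_le_coe]
          push_cast
          nlinarith [sq_nonneg ((d : ℝ) / 2 - 1)]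
        have h4 : ((d : ℝ≥0∞) ^ 2 / 4) = ((d ^ 2 / 4 : ℝ≥0) : ℝ≥0∞) := by
          rw [ENNReal.coe_div (by norm_num)]; norm_num
        rw [h4]
        exact_mod_cast this
  have hle : ∀ z, s * D z ≤ A z + D z * A' z + s / 4 * D z ^ 2 := by
    intro z
    calc s * D z ≤ s * (min 1 (D z) + D z ^ 2 / 4) := by gcongr; exact hmin _
      _ = s * min 1 (D z) + s / 4 * D z ^ 2 := by
          rw [mul_add, ENNReal.div_eq_inv_mul, ENNReal.div_eq_inv_mul]; ring
      _ ≤ (A z + A' z) * min 1 (D z) + s / 4 * D z ^ 2 := by gcongr; exact hsA z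
      _ ≤ A z + D z * A' z + s / 4 * D z ^ 2 := by
          rw [add_mul, mul_comm (D z)]
          gcongr
          · exact (mul_le_mul_right (min_le_left _ _) _).trans (mul_one _).le
          · exact min_le_right _ _
  have hint : s ≤ (∫⁻ z, A z ∂ν + ∫⁻ z, D z * A' z ∂ν) + s / 2 := by
    calc s = ∫⁻ z, s * D z ∂ν := by rw [lintegral_const_mul _ hD, hD1, mul_one]
      _ ≤ ∫⁻ z, (A z + D z * A' z + s / 4 * D z ^ 2) ∂ν := lintegral_mono hle
      _ = (∫⁻ z, A z ∂ν + ∫⁻ z, D z * A' z ∂ν) + s / 4 * ∫⁻ z, D z ^ 2 ∂ν := by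
          rw [lintegral_add_left (f := fun z => A z + D z * A' z) (hA.add (hD.mul hA')),
            lintegral_add_left hA,
            lintegral_const_mul _ (hD.pow_const 2)]
      _ ≤ (∫⁻ z, A z ∂ν + ∫⁻ z, D z * A' z ∂ν) + s / 4 * 2 := by gcongr
      _ = _ := by
          congr 1
          rw [ENNReal.div_eq_inv_mul, ENNReal.div_eq_inv_mul, mul_right_comm,
            show (4 : ℝ≥0∞) = 2 * 2 by norm_num,
            ENNReal.mul_inv (by simp) (by simp), mul_assoc (2⁻¹ : ℝ≥0∞) 2⁻¹ 2,
            ENNReal.inv_mul_cancel (by simp) (by simp), mul_one]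
  have hs2 : s / 2 ≠ ∞ := ENNReal.div_ne_top hs (by simp)
  rw [← ENNReal.add_le_add_iff_right hs2, ENNReal.add_halves]
  exact hint

/-! ### Densities of finite product measures -/

theorem lintegral_pi_prod_eq {ι : Type*} [Fintype ι] {X : ι → Type*}
    [∀ i, MeasurableSpace (X i)] (μ : ∀ i, Measure (X i)) [∀ i, IsProbabilityMeasure (μ i)]
    {f : ∀ i, X i → ℝ≥0∞} (hf : ∀ i, Measurable (f i)) :
    ∫⁻ x, ∏ i, f i (x i) ∂Measure.pi μ = ∏ i, ∫⁻ x, f i x ∂μ i := by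
  have hind : iIndepFun (fun i (x : ∀ i, X i) => f i (x i)) (Measure.pi μ) :=
    iIndepFun_pi (X := f) fun i => (hf i).aemeasurable
  have h := lintegral_prod_eq_prod_lintegral_of_indepFun Finset.univ _ hind
    fun i => (hf i).comp (measurable_pi_apply i)
  rw [h]
  refine Finset.prod_congr rfl fun i _ => ?_
  exact (measurePreserving_eval μ i).lintegral_comp (hf i)

theorem pi_withDensity {ι : Type*} [Fintype ι] {X : ι → Type*}
    [∀ i, MeasurableSpace (X i)] (μ μ' : ∀ i, Measure (X i)) [∀ i, IsProbabilityMeasure (μ i)]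
    [∀ i, IsProbabilityMeasure (μ' i)]
    {f : ∀ i, X i → ℝ≥0∞} (hf : ∀ i, Measurable (f i))
    (hμ' : ∀ i, μ' i = (μ i).withDensity (f i)) :
    Measure.pi μ' = (Measure.pi μ).withDensity fun x => ∏ i, f i (x i) := by
  refine Measure.pi_eq fun s hs => ?_
  rw [withDensity_apply _ (MeasurableSet.univ_pi hs),
    ← lintegral_indicator (MeasurableSet.univ_pi hs)]
  have : (univ.pi s).indicator (fun x : ∀ i, X i => ∏ i, f i (x i))
      = fun x => ∏ i, (s i).indicator (f i) (x i) := by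
    classical
    ext x
    by_cases hx : x ∈ univ.pi s
    · rw [indicator_of_mem hx]
      exact Finset.prod_congr rfl fun i _ => (indicator_of_mem (hx i (mem_univ i)) _).symm
    · rw [indicator_of_notMem hx]
      simp only [Set.mem_pi, mem_univ, true_implies, not_forall] at hx
      obtain ⟨i, hi⟩ := hx
      exact (Finset.prod_eq_zero (Finset.mem_univ i) (indicator_of_notMem hi _)).symm
  rw [this, lintegral_pi_prod_eq μ fun i => (hf i).indicator (hs i)]
  refine Finset.prod_congr rfl fun i _ => ?_
  rw [lintegral_indicator (hs i), hμ', withDensity_apply _ (hs i)]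

theorem pi_map_eq_withDensity {ι : Type*} [Fintype ι] {X : ι → Type*}
    [∀ i, MeasurableSpace (X i)] (μ : ∀ i, Measure (X i)) [∀ i, IsProbabilityMeasure (μ i)]
    {T : ∀ i, X i → X i} (hT : ∀ i, Measurable (T i))
    {f : ∀ i, X i → ℝ≥0∞} (hf : ∀ i, Measurable (f i))
    (h : ∀ i, (μ i).map (T i) = (μ i).withDensity (f i)) :
    (Measure.pi μ).map (fun x i => T i (x i))
      = (Measure.pi μ).withDensity fun x => ∏ i, f i (x i) := by
  have : ∀ i, IsProbabilityMeasure ((μ i).map (T i)) := fun i =>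
    Measure.isProbabilityMeasure_map (hT i).aemeasurable
  rw [Measure.pi_map_pi fun i => (hT i).aemeasurable]
  exact pi_withDensity μ _ hf h

/-! ### Gaussian translations -/

/-- The likelihood ratio of `N(m, v)` with respect to `N(0, v)`. -/
noncomputable def gaussianRatio (m : ℝ) (v : ℝ≥0) (x : ℝ) : ℝ≥0∞ :=
  ENNReal.ofReal (Real.exp ((m * x - m ^ 2 / 2) / v))

theorem measurable_gaussianRatio_uncurry (v : ℝ≥0) :
    Measurable fun p : ℝ × ℝ => gaussianRatio p.1 v p.2 := by
  unfold gaussianRatio; fun_prop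

theorem measurable_gaussianRatio (m : ℝ) (v : ℝ≥0) : Measurable (gaussianRatio m v) := by
  unfold gaussianRatio; fun_prop

/-- The degenerate case `v = 0` is kept because `δ = 0` is allowed; division by zero then makes the
ratio identically 1. -/
theorem gaussianReal_eq_withDensity {m : ℝ} {v : ℝ≥0} (h : v = 0 → m = 0) :
    gaussianReal m v = (gaussianReal 0 v).withDensity (gaussianRatio m v) := by
  rcases eq_or_ne v 0 with rfl | hv
  · rw [h rfl]
    have : gaussianRatio 0 0 = 1 := by ext; simp [gaussianRatio]
    rw [this, withDensity_one]
  · rw [gaussianReal_of_var_ne_zero _ hv, gaussianReal_of_var_ne_zero _ hv,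
      ← withDensity_mul _ (measurable_gaussianPDF 0 v) (measurable_gaussianRatio m v)]
    congr 1
    ext x
    simp only [Pi.mul_apply, gaussianPDF, gaussianRatio, gaussianPDFReal]
    rw [← ENNReal.ofReal_mul (by positivity), mul_assoc (√_)⁻¹, ← Real.exp_add]
    congr 3
    have : (v : ℝ) ≠ 0 := by exact_mod_cast hv
    field_simp
    ring

theorem lintegral_gaussianRatio {m : ℝ} {v : ℝ≥0} (h : v = 0 → m = 0) :
    ∫⁻ x, gaussianRatio m v x ∂gaussianReal 0 v = 1 := by
  have := measure_univ (μ := gaussianReal m v)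
  rwa [gaussianReal_eq_withDensity h, withDensity_apply _ MeasurableSet.univ,
    Measure.restrict_univ] at this

/-- The squared ratio for `m` is `exp(m²/v)` times the ratio for `2m`, which integrates to 1. -/
theorem lintegral_gaussianRatio_sq {m : ℝ} {v : ℝ≥0} (h : v = 0 → m = 0) :
    ∫⁻ x, gaussianRatio m v x ^ 2 ∂gaussianReal 0 v = ENNReal.ofReal (Real.exp (m ^ 2 / v)) := by
  have : ∀ x, gaussianRatio m v x ^ 2
      = ENNReal.ofReal (Real.exp (m ^ 2 / v)) * gaussianRatio (2 * m) v x := by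
    intro x
    simp only [gaussianRatio]
    rw [← ENNReal.ofReal_mul (by positivity), ← ENNReal.ofReal_pow (by positivity),
      ← Real.exp_add, ← Real.exp_nat_mul]
    congr 2
    push_cast
    ring
  simp_rw [this]
  rw [lintegral_const_mul _ (measurable_gaussianRatio _ _),
    lintegral_gaussianRatio fun hv => by rw [h hv, mul_zero], mul_one]

/-! ### The latent representation of the model -/

/-- The law of a covariate together with its independent baseline noise. -/
noncomputable def baseLaw (σ : ℝ≥0) : Measure (ℝ × ℝ) := covariateLaw.prod (gaussianReal 0 (σ ^ 2))

instance : IsProbabilityMeasure covariateLaw := ⟨by simp [covariateLaw]⟩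

instance (σ : ℝ≥0) : IsProbabilityMeasure (baseLaw σ) := by unfold baseLaw; infer_instance

theorem measurable_gaussianRatio_comp {u : ℝ → ℝ} (hu : Measurable u) (v : ℝ≥0) :
    Measurable fun p : ℝ × ℝ => gaussianRatio (u p.1) v p.2 :=
  (measurable_gaussianRatio_uncurry v).comp ((hu.comp measurable_fst).prodMk measurable_snd)

theorem baseLaw_map_shift {σ : ℝ≥0} (hσ : 0 < σ) {u : ℝ → ℝ} (hu : Measurable u) :
    (baseLaw σ).map (fun p => (p.1, p.2 + u p.1))
      = (baseLaw σ).withDensity fun p => gaussianRatio (u p.1) (σ ^ 2) p.2 := by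
  have hm : Measurable fun p : ℝ × ℝ => (p.1, p.2 + u p.1) := by fun_prop
  have hr := measurable_gaussianRatio_comp hu (σ ^ 2)
  refine Measure.ext_of_lintegral _ fun g hg => ?_
  rw [lintegral_map hg hm, lintegral_withDensity_eq_lintegral_mul _ hr hg, baseLaw,
    lintegral_prod (fun p => g (p.1, p.2 + u p.1)) (hg.comp hm).aemeasurable, lintegral_prod _ (hr.mul hg).aemeasurable]
  refine lintegral_congr fun x => ?_
  have hgx : Measurable fun e => g (x, e) := hg.comp (by fun_prop)
  have h := gaussianReal_eq_withDensity (m := u x) (v := σ ^ 2)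
    fun h => absurd h (pow_pos hσ 2).ne'
  calc ∫⁻ e, g (x, e + u x) ∂gaussianReal 0 (σ ^ 2)
      = ∫⁻ e, g (x, e) ∂gaussianReal (u x) (σ ^ 2) := by
        have := gaussianReal_map_add_const (μ := 0) (v := σ ^ 2) (u x)
        rw [zero_add] at this
        rw [← this, lintegral_map hgx (by fun_prop)]
    _ = _ := by
        rw [h, lintegral_withDensity_eq_lintegral_mul _ (measurable_gaussianRatio _ _) hgx]
        rfl

theorem lintegral_baseLaw_gaussianRatio_sq {σ : ℝ≥0} (hσ : 0 < σ) {u : ℝ → ℝ} (hu : Measurable u) :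
    ∫⁻ p, gaussianRatio (u p.1) (σ ^ 2) p.2 ^ 2 ∂baseLaw σ
      = ∫⁻ x, ENNReal.ofReal (Real.exp (u x ^ 2 / (σ : ℝ) ^ 2)) ∂covariateLaw := by
  rw [baseLaw, lintegral_prod _ ((measurable_gaussianRatio_comp hu _).pow_const 2).aemeasurable]
  refine lintegral_congr fun x => ?_
  refine (lintegral_gaussianRatio_sq (m := u x) fun h => absurd h (pow_pos hσ 2).ne').trans ?_
  simp

theorem measurable_bucket (B : ℕ+) : Measurable (bucket B) := by
  have h : Measurable fun x : ℝ => min ⌊(B : ℝ) * x⌋₊ ((B : ℕ) - 1) := by fun_prop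
  have h2 : Measurable fun k : ℕ => (if hk : k < B then ⟨k, hk⟩ else ⟨0, B.pos⟩ : Fin B) :=
    measurable_from_nat
  convert h2.comp h using 1
  ext x
  have : min ⌊(B : ℝ) * x⌋₊ ((B : ℕ) - 1) < B := by have := B.pos; omega
  simp [bucket, Function.comp]

/-- Evaluation at a random index is a finite sum over the possible indices. -/
theorem measurable_shift_bucket (B : ℕ+) :
    Measurable fun p : (Fin B → ℝ) × ℝ => p.1 (bucket B p.2) := by
  have : (fun p : (Fin B → ℝ) × ℝ => p.1 (bucket B p.2))
      = fun p => ∑ b, if bucket B p.2 = b then p.1 b else 0 := by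
    ext p; simp
  rw [this]
  refine Finset.measurable_sum _ fun b _ => Measurable.ite ?_ (by fun_prop) measurable_const
  exact (measurable_bucket B).comp measurable_snd (measurableSet_singleton b)

/-- The sample as a function of the bucket shifts, the covariates and the baseline noise. -/
noncomputable def sample (B : ℕ+) (n : ℕ) (f : ℝ → ℝ) (z : (Fin B → ℝ) × (Fin n → ℝ × ℝ)) :
    Fin n → ℝ × ℝ :=
  fun i => ((z.2 i).1, f (z.2 i).1 + ((z.2 i).2 + z.1 (bucket B (z.2 i).1)))

theorem measurable_sample (B : ℕ+) (n : ℕ) {f : ℝ → ℝ} (hf : Measurable f) :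
    Measurable (sample B n f) := by
  refine measurable_pi_lambda _ fun i => ?_
  have hx : Measurable fun z : (Fin B → ℝ) × (Fin n → ℝ × ℝ) => (z.2 i).1 := by fun_prop
  have h1 : Measurable fun z : (Fin B → ℝ) × (Fin n → ℝ × ℝ) => z.1 (bucket B (z.2 i).1) :=
    (measurable_shift_bucket B).comp (measurable_fst.prodMk hx)
  have h2 : Measurable fun z : (Fin B → ℝ) × (Fin n → ℝ × ℝ) => (z.2 i).2 := by fun_prop
  exact hx.prodMk ((hf.comp hx).add (h2.add h1))

/-- The joint law of bucket shifts, covariates and baseline noise. -/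
noncomputable def latentLaw (σ δ : ℝ≥0) (B : ℕ+) (n : ℕ) :
    Measure ((Fin B → ℝ) × (Fin n → ℝ × ℝ)) :=
  (perturbationLaw σ δ B).prod (Measure.pi fun _ : Fin n => baseLaw σ)

instance (σ δ : ℝ≥0) (B : ℕ+) : IsProbabilityMeasure (perturbationLaw σ δ B) := by
  unfold perturbationLaw; infer_instance

instance (σ δ : ℝ≥0) (B : ℕ+) (n : ℕ) : IsProbabilityMeasure (latentLaw σ δ B n) := by
  unfold latentLaw; infer_instance

/-- The integrating measure no longer depends on `f`, so the risks of different regression functions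
become comparable by a change of variables. -/
theorem scaledRisk_eq_lintegral_latentLaw (σ δ : ℝ≥0) (B : ℕ+) (n : ℕ) (r x₀ : ℝ)
    {g : (Fin n → ℝ × ℝ) → ℝ} (hg : Measurable g) {f : ℝ → ℝ} (hf : Measurable f) :
    scaledRisk σ δ B n r x₀ g f
      = ∫⁻ z, ENNReal.ofReal (r * (g (sample B n f z) - f x₀) ^ 2) ∂latentLaw σ δ B n := by
  have hG : Measurable fun D => ENNReal.ofReal (r * (g D - f x₀) ^ 2) := by fun_prop
  rw [scaledRisk, latentLaw,
    lintegral_prod (fun z => ENNReal.ofReal (r * (g (sample B n f z) - f x₀) ^ 2))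
      (hG.comp (measurable_sample B n hf)).aemeasurable]
  refine lintegral_congr fun ξ => ?_
  have hT : Measurable fun p : ℝ × ℝ => (p.1, f p.1 + (p.2 + ξ (bucket B p.1))) := by
    have : Measurable fun p : ℝ × ℝ => ξ (bucket B p.1) :=
      (measurable_of_finite ξ).comp ((measurable_bucket B).comp measurable_fst)
    exact measurable_fst.prodMk ((hf.comp measurable_fst).add (measurable_snd.add this))
  have : IsProbabilityMeasure (perturbedLaw σ B f ξ) :=
    Measure.isProbabilityMeasure_map (μ := baseLaw σ) hT.aemeasurable
  have hpi : (Measure.pi fun _ : Fin n => perturbedLaw σ B f ξ)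
      = (Measure.pi fun _ : Fin n => baseLaw σ).map fun ω => sample B n f (ξ, ω) := by
    have : ∀ _ : Fin n, SigmaFinite
        ((baseLaw σ).map fun p : ℝ × ℝ => (p.1, f p.1 + (p.2 + ξ (bucket B p.1)))) := fun _ => by
      change SigmaFinite (perturbedLaw σ B f ξ); infer_instance
    exact (Measure.pi_map_pi (μ := fun _ : Fin n => baseLaw σ) fun _ => hT.aemeasurable).symm
  have hS : Measurable fun ω => sample B n f (ξ, ω) :=
    (measurable_sample B n hf).comp measurable_prodMk_left
  rw [hpi, lintegral_map hG hS]

/-! ### Likelihood ratio of translated latent variables -/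

/-- The likelihood ratio of the latent variables after bucket shifts `m` and a regression shift
`u`. -/
noncomputable def latentRatio (σ δ : ℝ≥0) (B : ℕ+) (n : ℕ) (m : Fin B → ℝ) (u : ℝ → ℝ)
    (z : (Fin B → ℝ) × (Fin n → ℝ × ℝ)) : ℝ≥0∞ :=
  (∏ b, gaussianRatio (m b) (δ ^ 2 * σ ^ 2) (z.1 b)) *
    ∏ i, gaussianRatio (u (z.2 i).1) (σ ^ 2) (z.2 i).2

theorem latentLaw_map_shift {σ δ : ℝ≥0} (hσ : 0 < σ) {B : ℕ+} (n : ℕ) {m : Fin B → ℝ}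
    (hm : δ = 0 → m = 0) {u : ℝ → ℝ} (hu : Measurable u) :
    (latentLaw σ δ B n).map (fun z => (fun b => z.1 b + m b,
        fun i => ((z.2 i).1, (z.2 i).2 + u (z.2 i).1)))
      = (latentLaw σ δ B n).withDensity (latentRatio σ δ B n m u) := by
  have hs : Measurable fun p : ℝ × ℝ => (p.1, p.2 + u p.1) := by fun_prop
  have hv : ∀ b, δ ^ 2 * σ ^ 2 = 0 → m b = 0 := by
    intro b h
    have : δ = 0 := by simpa [hσ.ne'] using h
    simp [hm this]
  have h1 : (perturbationLaw σ δ B).map (fun ξ b => ξ b + m b)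
      = (perturbationLaw σ δ B).withDensity
          fun ξ => ∏ b, gaussianRatio (m b) (δ ^ 2 * σ ^ 2) (ξ b) := by
    refine pi_map_eq_withDensity (fun _ => gaussianReal 0 (δ ^ 2 * σ ^ 2))
      (T := fun b x => x + m b) (fun b => by fun_prop)
      (fun b => measurable_gaussianRatio _ _) fun b => ?_
    rw [gaussianReal_map_add_const, zero_add]
    exact gaussianReal_eq_withDensity (hv b)
  have h2 : (Measure.pi fun _ : Fin n => baseLaw σ).map
        (fun ω i => ((ω i).1, (ω i).2 + u (ω i).1))
      = (Measure.pi fun _ : Fin n => baseLaw σ).withDensity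
          fun ω => ∏ i, gaussianRatio (u (ω i).1) (σ ^ 2) (ω i).2 := by
    exact pi_map_eq_withDensity (fun _ : Fin n => baseLaw σ)
      (T := fun _ p => (p.1, p.2 + u p.1)) (fun _ => hs)
      (f := fun _ p => gaussianRatio (u p.1) (σ ^ 2) p.2)
      (fun _ => measurable_gaussianRatio_comp hu _) fun _ => baseLaw_map_shift hσ hu
  have hm1 : Measurable fun ξ : Fin B → ℝ => fun b => ξ b + m b := by fun_prop
  have hm2 : Measurable fun ω : Fin n → ℝ × ℝ => fun i => ((ω i).1, (ω i).2 + u (ω i).1) := by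
    fun_prop
  have hd1 : Measurable fun ξ : Fin B → ℝ =>
      ∏ b, gaussianRatio (m b) (δ ^ 2 * σ ^ 2) (ξ b) :=
    Finset.measurable_prod _ fun b _ => (measurable_gaussianRatio _ _).comp (measurable_pi_apply b)
  have hd2 : Measurable fun ω : Fin n → ℝ × ℝ =>
      ∏ i, gaussianRatio (u (ω i).1) (σ ^ 2) (ω i).2 :=
    Finset.measurable_prod _ fun i _ =>
      (measurable_gaussianRatio_comp hu _).comp (measurable_pi_apply i)
  have h3 := Measure.map_prod_map (perturbationLaw σ δ B) (Measure.pi fun _ : Fin n => baseLaw σ)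
    hm1 hm2
  rw [h1, h2, prod_withDensity hd1 hd2] at h3
  exact h3.symm

theorem measurable_latentRatio (σ δ : ℝ≥0) (B : ℕ+) (n : ℕ) (m : Fin B → ℝ) {u : ℝ → ℝ}
    (hu : Measurable u) : Measurable (latentRatio σ δ B n m u) := by
  refine Measurable.mul (Finset.measurable_prod _ fun b _ => ?_)
    (Finset.measurable_prod _ fun i _ => ?_)
  · exact (measurable_gaussianRatio _ _).comp ((measurable_pi_apply b).comp measurable_fst)
  · exact (measurable_gaussianRatio_comp hu _).comp ((measurable_pi_apply i).comp measurable_snd)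

theorem lintegral_latentRatio_sq {σ δ : ℝ≥0} (hσ : 0 < σ) {B : ℕ+} (n : ℕ) {m : Fin B → ℝ}
    (hm : δ = 0 → m = 0) {u : ℝ → ℝ} (hu : Measurable u) :
    ∫⁻ z, latentRatio σ δ B n m u z ^ 2 ∂latentLaw σ δ B n
      = ENNReal.ofReal (Real.exp (∑ b, m b ^ 2 / ((δ : ℝ) ^ 2 * (σ : ℝ) ^ 2))) *
        (∫⁻ x, ENNReal.ofReal (Real.exp (u x ^ 2 / (σ : ℝ) ^ 2)) ∂covariateLaw) ^ n := by
  have hv : ∀ b, δ ^ 2 * σ ^ 2 = 0 → m b = 0 := by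
    intro b h
    have : δ = 0 := by simpa [hσ.ne'] using h
    simp [hm this]
  have hd1 : Measurable fun ξ : Fin B → ℝ =>
      ∏ b, gaussianRatio (m b) (δ ^ 2 * σ ^ 2) (ξ b) ^ 2 :=
    Finset.measurable_prod _ fun b _ =>
      ((measurable_gaussianRatio _ _).pow_const 2).comp (measurable_pi_apply b)
  have hd2 : Measurable fun ω : Fin n → ℝ × ℝ =>
      ∏ i, gaussianRatio (u (ω i).1) (σ ^ 2) (ω i).2 ^ 2 :=
    Finset.measurable_prod _ fun i _ =>
      ((measurable_gaussianRatio_comp hu _).pow_const 2).comp (measurable_pi_apply i)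
  simp only [latentRatio, mul_pow, ← Finset.prod_pow]
  rw [latentLaw, lintegral_prod_mul hd1.aemeasurable hd2.aemeasurable, perturbationLaw,
    lintegral_pi_prod_eq (fun _ : Fin B => gaussianReal 0 (δ ^ 2 * σ ^ 2))
      (f := fun b x => gaussianRatio (m b) (δ ^ 2 * σ ^ 2) x ^ 2)
      fun b => (measurable_gaussianRatio _ _).pow_const 2,
    lintegral_pi_prod_eq (fun _ : Fin n => baseLaw σ)
      (f := fun _ p => gaussianRatio (u p.1) (σ ^ 2) p.2 ^ 2)
      fun _ => (measurable_gaussianRatio_comp hu _).pow_const 2]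
  simp only [lintegral_baseLaw_gaussianRatio_sq hσ hu, Finset.prod_const, Finset.card_univ,
    Fintype.card_fin]
  congr 1
  rw [Real.exp_sum, ENNReal.ofReal_prod_of_nonneg fun _ _ => by positivity]
  refine Finset.prod_congr rfl fun b _ => ?_
  rw [lintegral_gaussianRatio_sq (hv b)]
  simp

/-- The two-point lower bound, for the regression functions `0` and `f`. The function `f` is split
into a part `m` absorbed by the bucket shifts and a remainder. -/
theorem two_point_bound {σ δ : ℝ≥0} (hσ : 0 < σ) {B : ℕ+} (n : ℕ) {r x₀ : ℝ} (hr : 0 ≤ r)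
    {g : (Fin n → ℝ × ℝ) → ℝ} (hg : Measurable g) {f : ℝ → ℝ} (hf : Measurable f)
    {m : Fin B → ℝ} (hm : δ = 0 → m = 0)
    (h2 : ENNReal.ofReal (Real.exp (∑ b, m b ^ 2 / ((δ : ℝ) ^ 2 * (σ : ℝ) ^ 2))) *
        (∫⁻ x, ENNReal.ofReal (Real.exp ((f x - m (bucket B x)) ^ 2 / (σ : ℝ) ^ 2))
          ∂covariateLaw) ^ n ≤ 2) :
    ENNReal.ofReal (r * f x₀ ^ 2 / 2) / 2
      ≤ scaledRisk σ δ B n r x₀ g (fun _ => 0) + scaledRisk σ δ B n r x₀ g f := by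
  have hu : Measurable fun x => f x - m (bucket B x) :=
    hf.sub ((measurable_of_finite m).comp (measurable_bucket B))
  have hD := measurable_latentRatio σ δ B n m hu
  have hS0 := measurable_sample B n (f := fun _ => 0) measurable_const
  have hA : ∀ c : ℝ, Measurable fun z =>
      ENNReal.ofReal (r * (g (sample B n (fun _ => 0) z) - c) ^ 2) := by
    intro c
    have := hg.comp hS0
    have h' : Measurable fun z => g (sample B n (fun _ => 0) z) := this
    fun_prop
  have hmap := latentLaw_map_shift hσ n hm hu
  have hshift : Measurable fun z : (Fin B → ℝ) × (Fin n → ℝ × ℝ) => ((fun b => z.1 b + m b,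
      fun i => ((z.2 i).1, (z.2 i).2 + (f (z.2 i).1 - m (bucket B (z.2 i).1)))) :
      (Fin B → ℝ) × (Fin n → ℝ × ℝ)) := by
    have hu' : ∀ i, Measurable fun z : (Fin B → ℝ) × (Fin n → ℝ × ℝ) =>
        f (z.2 i).1 - m (bucket B (z.2 i).1) := fun i =>
      hu.comp (measurable_fst.comp ((measurable_pi_apply i).comp measurable_snd))
    fun_prop
  rw [scaledRisk_eq_lintegral_latentLaw σ δ B n r x₀ hg measurable_const,
    scaledRisk_eq_lintegral_latentLaw σ δ B n r x₀ hg hf]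
  have hrisk : ∫⁻ z, ENNReal.ofReal (r * (g (sample B n f z) - f x₀) ^ 2) ∂latentLaw σ δ B n
      = ∫⁻ z, latentRatio σ δ B n m (fun x => f x - m (bucket B x)) z *
          ENNReal.ofReal (r * (g (sample B n (fun _ => 0) z) - f x₀) ^ 2) ∂latentLaw σ δ B n := by
    refine Eq.trans ?_ (lintegral_withDensity_eq_lintegral_mul _ hD (hA (f x₀)))
    rw [← hmap, lintegral_map (hA (f x₀)) hshift]
    refine lintegral_congr fun z => ?_
    -- The `m` added to the bucket shift cancels the `m` subtracted from the noise, leaving `f`.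
    have : sample B n f z = sample B n (fun _ => 0) (fun b => z.1 b + m b,
        fun i => ((z.2 i).1, (z.2 i).2 + (f (z.2 i).1 - m (bucket B (z.2 i).1)))) := by
      ext i
      · rfl
      · simp only [sample]; ring
    rw [this]
  rw [hrisk]
  refine half_le_lintegral_add_lintegral_mul (hA 0) (hA (f x₀)) hD ENNReal.ofReal_ne_top ?_ ?_ ?_
  · intro z
    rw [← ENNReal.ofReal_add (by positivity) (by positivity)]
    refine ENNReal.ofReal_le_ofReal ?_
    -- With `c = f x₀`, `g² + (g - c)² - c²/2 = (2g - c)²/2`.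
    have := mul_nonneg hr (sq_nonneg (2 * g (sample B n (fun _ => 0) z) - f x₀))
    nlinarith
  · have h1 : IsProbabilityMeasure ((latentLaw σ δ B n).withDensity
        (latentRatio σ δ B n m fun x => f x - m (bucket B x))) := by
      rw [← hmap]; exact Measure.isProbabilityMeasure_map hshift.aemeasurable
    have := h1.measure_univ
    rwa [withDensity_apply _ MeasurableSet.univ, Measure.restrict_univ] at this
  · rw [lintegral_latentRatio_sq hσ n hm hu]
    exact h2

/-! ### Members of the Hölder class -/

theorem zero_mem_holderClass {β L : ℝ} (hL : 0 < L) : (fun _ => (0 : ℝ)) ∈ holderClass β L := by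
  refine ⟨contDiffOn_const, fun x _ x' _ => ?_⟩
  have h : ∀ y, iteratedDerivWithin (holderOrder β) (fun _ : ℝ => (0 : ℝ)) (Icc 0 1) y = 0 := by
    intro y
    simp
  rw [h, h, sub_zero, abs_zero]
  positivity

theorem holderOrder_lt {β : ℝ} (hβ : 0 < β) : 0 < β - holderOrder β := by
  have h1 : (⌈β⌉₊ : ℝ) < β + 1 := Nat.ceil_lt_add_one hβ.le
  have h2 : 1 ≤ ⌈β⌉₊ := Nat.one_le_ceil_iff.2 hβ
  rw [holderOrder, Nat.cast_sub h2]
  push_cast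
  linarith

theorem sub_holderOrder_le_one {β : ℝ} : β - holderOrder β ≤ 1 := by
  have h1 : β ≤ ⌈β⌉₊ := Nat.le_ceil β
  have h2 : ⌈β⌉₊ ≤ holderOrder β + 1 := by rw [holderOrder]; omega
  have h3 : (⌈β⌉₊ : ℝ) ≤ holderOrder β + 1 := by exact_mod_cast h2
  linarith

/-- At distances below 1 the Lipschitz bound is the stronger one; above 1 the trivial bound `2M`
suffices. -/
theorem abs_sub_le_mul_rpow_of_bounded_of_lipschitz {ψ : ℝ → ℝ} {M K γ : ℝ}
    (hM : ∀ x, |ψ x| ≤ M) (hK : ∀ x y, |ψ x - ψ y| ≤ K * |x - y|)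
    (hγ0 : 0 ≤ γ) (hγ1 : γ ≤ 1) (x y : ℝ) :
    |ψ x - ψ y| ≤ max (2 * M) K * |x - y| ^ γ := by
  have hM0 : 0 ≤ M := (abs_nonneg _).trans (hM 0)
  rcases le_total |x - y| 1 with h | h
  · calc |ψ x - ψ y| ≤ K * |x - y| := hK x y
      _ ≤ max (2 * M) K * |x - y| := by gcongr; exact le_max_right _ _
      _ ≤ max (2 * M) K * |x - y| ^ γ := by
        refine mul_le_mul_of_nonneg_left ?_ (le_max_of_le_left (by positivity))
        calc |x - y| = |x - y| ^ (1 : ℝ) := (Real.rpow_one _).symm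
          _ ≤ _ := Real.rpow_le_rpow_of_exponent_ge' (abs_nonneg _) h hγ0 hγ1
  · calc |ψ x - ψ y| ≤ |ψ x| + |ψ y| := abs_sub _ _
      _ ≤ 2 * M * 1 := by linarith [hM x, hM y]
      _ ≤ max (2 * M) K * |x - y| ^ γ := by
        exact mul_le_mul (le_max_left _ _) (Real.one_le_rpow h hγ0) zero_le_one
          (le_max_of_le_left (by positivity))

/-- A kernel `φ` supported in `[-1, 1]` whose rescalings `a h ^ β φ ((x - x₀) / h)` belong to the
Hölder class for all sufficiently small amplitudes `a`. -/
theorem exists_holder_bump {β : ℝ} (hβ : 0 < β) :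
    ∃ (φ : ℝ → ℝ) (K Λ : ℝ), 0 < K ∧ 0 ≤ Λ ∧ Continuous φ ∧ φ 0 = 1 ∧ (∀ x, |φ x| ≤ 1) ∧
      (∀ x, 1 ≤ |x| → φ x = 0) ∧ (∀ x y, |φ x - φ y| ≤ Λ * |x - y|) ∧
      ∀ L x₀ h a : ℝ, 0 < h → 0 ≤ a → a * K ≤ L →
        (fun x => a * h ^ β * φ ((x - x₀) / h)) ∈ holderClass β L := by
  let φ : ContDiffBump (0 : ℝ) := ⟨1 / 2, 1, by norm_num, by norm_num⟩
  set ℓ := holderOrder β with hℓ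
  have hsm : ∀ k : ℕ, ContDiff ℝ 1 (iteratedDeriv k φ) := fun k => by
    rw [iteratedDeriv_eq_iterate]
    exact ContDiff.iterate_deriv' 1 k φ.contDiff
  have hcs : ∀ k : ℕ, HasCompactSupport (iteratedDeriv k φ) := fun k => by
    induction k with
    | zero => simpa using φ.hasCompactSupport
    | succ k ih => rw [iteratedDeriv_succ]; exact ih.deriv
  have hlip : ∀ k : ℕ, ∃ K : ℝ, 0 ≤ K ∧
      ∀ x y, |iteratedDeriv k φ x - iteratedDeriv k φ y| ≤ K * |x - y| := by
    intro k
    obtain ⟨C, hC⟩ := ContDiff.lipschitzWith_of_hasCompactSupport (hcs k) (hsm k) one_ne_zero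
    refine ⟨C, C.2, fun x y => ?_⟩
    simpa [Real.dist_eq] using hC.dist_le_mul x y
  obtain ⟨Λ, hΛ0, hΛ⟩ := hlip 0
  obtain ⟨K₁, -, hK₁⟩ := hlip ℓ
  obtain ⟨M, hM⟩ := (hcs ℓ).exists_bound_of_continuous (hsm ℓ).continuous
  have hγ0 := holderOrder_lt hβ
  have hH := abs_sub_le_mul_rpow_of_bounded_of_lipschitz hM hK₁ hγ0.le sub_holderOrder_le_one
  have hK0 : 0 ≤ max (2 * M) K₁ :=
    le_max_of_le_left (by linarith [(norm_nonneg _).trans (hM 0)])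
  -- The `+ 1` only serves to make the constant strictly positive, so that the amplitude can later
  -- be taken as `L / K`.
  refine ⟨φ, max (2 * M) K₁ + 1, Λ, by linarith, hΛ0, φ.continuous, ?_, ?_, ?_, ?_, ?_⟩
  · exact φ.one_of_mem_closedBall (by simp [φ])
  · intro x
    rw [abs_of_nonneg φ.nonneg]
    exact φ.le_one
  · intro x hx
    exact φ.zero_of_le_dist (by simpa [φ, Real.dist_eq] using hx)
  · simpa using hΛ
  · intro L x₀ h a hh ha haK
    have hcomp : ContDiff ℝ ℓ fun x => φ ((x - x₀) / h) :=
      φ.contDiff.comp (by fun_prop)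
    have hfull : ContDiff ℝ ℓ fun x => a * h ^ β * φ ((x - x₀) / h) := contDiff_const.mul hcomp
    refine ⟨hfull.contDiffOn, fun x hx x' hx' => ?_⟩
    -- Differentiating `ℓ` times leaves the factor `h^(β-ℓ)`, which exactly offsets the rescaling of
    -- distances in the `(β-ℓ)`-Hölder bound.
    have hder : ∀ y ∈ Icc (0 : ℝ) 1,
        iteratedDerivWithin ℓ (fun x => a * h ^ β * φ ((x - x₀) / h)) (Icc 0 1) y
          = a * h ^ (β - ℓ) * iteratedDeriv ℓ φ ((y - x₀) / h) := by
      intro y hy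
      rw [iteratedDerivWithin_eq_iteratedDeriv (uniqueDiffOn_Icc zero_lt_one)
        hfull.contDiffAt hy, iteratedDeriv_const_mul_field]
      have h1 : iteratedDeriv ℓ (fun x => φ ((x - x₀) / h)) y
          = (h⁻¹) ^ ℓ * iteratedDeriv ℓ φ ((y - x₀) / h) := by
        have h2 : (fun x => φ ((x - x₀) / h))
            = fun x => (fun w => φ (h⁻¹ * w)) (x - x₀) := by
          ext x; simp only; congr 1; field_simp
        have h3 := iteratedDeriv_comp_const_mul (n := ℓ) (f := φ) φ.contDiff h⁻¹
        rw [h2, iteratedDeriv_comp_sub_const ℓ (fun w => φ (h⁻¹ * w)) x₀]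
        simp only [h3]
        congr 2; field_simp
      rw [h1, Real.rpow_sub hh, Real.rpow_natCast, inv_pow]
      ring
    rw [hder x hx, hder x' hx', ← mul_sub, abs_mul, abs_of_nonneg (by positivity)]
    have hdist : |(x - x₀) / h - (x' - x₀) / h| = |x - x'| / h := by
      rw [← sub_div, sub_sub_sub_cancel_right, abs_div, abs_of_pos hh]
    calc a * h ^ (β - ℓ) * |iteratedDeriv ℓ φ ((x - x₀) / h) - iteratedDeriv ℓ φ ((x' - x₀) / h)|
        ≤ a * h ^ (β - ℓ) * (max (2 * M) K₁ * (|x - x'| / h) ^ (β - ℓ)) := by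
          gcongr
          rw [← hdist]
          exact hH _ _
      _ = a * max (2 * M) K₁ * |x - x'| ^ (β - ℓ) := by
          rw [Real.div_rpow (abs_nonneg _) hh.le]
          have : h ^ (β - ℓ) ≠ 0 := (Real.rpow_pos_of_pos hh _).ne'
          field_simp
      _ ≤ L * |x - x'| ^ (β - ℓ) := by
          gcongr
          nlinarith

/-! ### Bucket geometry and perturbation strength -/

theorem bucket_le {B : ℕ+} {x : ℝ} (hx : x ∈ Icc (0 : ℝ) 1) : (bucket B x : ℝ) / B ≤ x := by
  have hB : (0 : ℝ) < B := by exact_mod_cast B.pos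
  rw [div_le_iff₀ hB, mul_comm]
  have h1 : ((bucket B x : ℕ) : ℝ) ≤ (⌊(B : ℝ) * x⌋₊ : ℝ) := by
    exact_mod_cast min_le_left _ _
  exact h1.trans (Nat.floor_le (mul_nonneg hB.le hx.1))

theorem le_bucket_add_one {B : ℕ+} {x : ℝ} (hx : x ∈ Icc (0 : ℝ) 1) :
    x ≤ ((bucket B x : ℝ) + 1) / B := by
  have hB : (0 : ℝ) < B := by exact_mod_cast B.pos
  rw [le_div_iff₀ hB, mul_comm]
  rcases min_choice ⌊(B : ℝ) * x⌋₊ ((B : ℕ) - 1) with h | h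
  · have h1 : (bucket B x : ℕ) = ⌊(B : ℝ) * x⌋₊ := h
    rw [h1]
    exact (Nat.lt_floor_add_one _).le
  · have h1 : (bucket B x : ℕ) = (B : ℕ) - 1 := h
    have h2 : ((bucket B x : ℕ) : ℝ) + 1 = B := by
      rw [h1]
      have := B.pos
      exact_mod_cast Nat.sub_add_cancel this
    rw [h2]
    nlinarith [hx.2]

theorem abs_sub_bucket_le {B : ℕ+} {x : ℝ} (hx : x ∈ Icc (0 : ℝ) 1) :
    |x - (bucket B x : ℝ) / B| ≤ 1 / B := by
  have h1 := bucket_le (B := B) hx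
  have h2 := le_bucket_add_one (B := B) hx
  rw [add_div] at h2
  rw [abs_of_nonneg (by linarith)]
  linarith

theorem avgCorr_nonneg (B : ℕ+) : 0 ≤ avgCorr B :=
  integral_nonneg fun x => integral_nonneg fun x' => by
    unfold corrKernel; split_ifs <;> simp

theorem avgCorr_le (B : ℕ+) : avgCorr B ≤ 1 / B := by
  have hB : (0 : ℝ) < B := by exact_mod_cast B.pos
  have hinner : ∀ x, ∫ x', corrKernel B x x' ∂covariateLaw ≤ 1 / B := by
    intro x
    have hS : MeasurableSet {x' | bucket B x = bucket B x'} :=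
      (measurable_bucket B) (measurableSet_eq_fun measurable_const measurable_id)
    have h1 : (fun x' => corrKernel B x x')
        = {x' | bucket B x = bucket B x'}.indicator fun _ => (1 : ℝ) := by
      ext x'; simp [corrKernel, indicator_apply]
    rw [h1, integral_indicator_const _ hS, smul_eq_mul, mul_one, covariateLaw,
      measureReal_restrict_apply hS]
    have h2 : {x' | bucket B x = bucket B x'} ∩ Icc 0 1
        ⊆ Icc ((bucket B x : ℝ) / B) (((bucket B x : ℝ) + 1) / B) := by
      rintro y ⟨hy, hy1⟩
      rw [Set.mem_ofPred_eq] at hy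
      rw [hy]
      exact ⟨bucket_le hy1, le_bucket_add_one hy1⟩
    refine (measureReal_mono h2 (by simp)).trans ?_
    rw [Real.volume_real_Icc_of_le (by gcongr; linarith)]
    apply le_of_eq
    ring
  calc avgCorr B ≤ ∫ _, (1 / (B : ℝ)) ∂covariateLaw :=
        integral_mono_of_nonneg (ae_of_all _ fun x => integral_nonneg fun x' => by
          unfold corrKernel; split_ifs <;> simp) (integrable_const _) (ae_of_all _ hinner)
    _ = 1 / B := by simp

theorem strength_nonneg (δ : ℝ≥0) (B : ℕ+) : 0 ≤ strength δ B :=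
  mul_nonneg (sq_nonneg _) (avgCorr_nonneg B)

theorem strength_le (δ : ℝ≥0) (B : ℕ+) : strength δ B ≤ (δ : ℝ) ^ 2 / B := by
  rw [strength, div_eq_mul_one_div]
  gcongr
  exact avgCorr_le B

/-! ### Bounding the second moment for the bump -/

open Classical in
theorem card_gridPoints_le (B : ℕ+) (x₀ : ℝ) {h : ℝ} (hh : 0 ≤ h) :
    ((Finset.univ.filter fun b : Fin B => |(b : ℝ) / B - x₀| ≤ h).card : ℝ) ≤ 2 * (B * h) + 1 := by
  have hB : (0 : ℝ) < B := by exact_mod_cast B.pos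
  have hsub : (Finset.univ.filter fun b : Fin B => |(b : ℝ) / B - x₀| ≤ h).map Fin.valEmbedding
      ⊆ Finset.Icc ⌈(B : ℝ) * (x₀ - h)⌉₊ ⌊(B : ℝ) * (x₀ + h)⌋₊ := by
    intro k hk
    simp only [Finset.mem_map, Finset.mem_filter, Finset.mem_univ, true_and,
      Fin.valEmbedding_apply] at hk
    obtain ⟨b, hb, rfl⟩ := hk
    rw [abs_le] at hb
    have hbB : (b : ℝ) = B * ((b : ℝ) / B) := by field_simp
    rw [Finset.mem_Icc]
    constructor
    · rw [Nat.ceil_le, hbB]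
      gcongr; linarith [hb.1]
    · refine Nat.le_floor ?_
      rw [hbB]
      gcongr; linarith [hb.2]
  have hcard := Finset.card_le_card hsub
  rw [Finset.card_map, Nat.card_Icc] at hcard
  have hnn : 0 ≤ (B : ℝ) * h := by positivity
  rcases le_total ⌈(B : ℝ) * (x₀ - h)⌉₊ (⌊(B : ℝ) * (x₀ + h)⌋₊ + 1) with hle | hle
  · have h1 : ((Finset.univ.filter fun b : Fin B => |(b : ℝ) / B - x₀| ≤ h).card : ℝ)
        ≤ (⌊(B : ℝ) * (x₀ + h)⌋₊ : ℝ) + 1 - ⌈(B : ℝ) * (x₀ - h)⌉₊ := by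
      have := Nat.cast_le (α := ℝ).2 hcard
      rwa [Nat.cast_sub hle, Nat.cast_add, Nat.cast_one] at this
    have h2 := Nat.le_ceil ((B : ℝ) * (x₀ - h))
    rcases le_total 0 ((B : ℝ) * (x₀ + h)) with h3 | h3
    · have := Nat.floor_le h3
      nlinarith
    · rw [Nat.floor_of_nonpos h3] at h1
      have : (0 : ℝ) ≤ (⌈(B : ℝ) * (x₀ - h)⌉₊ : ℝ) := Nat.cast_nonneg _
      push_cast at h1
      linarith
  · rw [Nat.sub_eq_zero_of_le hle, Nat.le_zero] at hcard
    rw [hcard]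
    push_cast
    linarith

theorem sum_bump_sq_le {φ : ℝ → ℝ} (hφ1 : ∀ x, |φ x| ≤ 1) (hφ0 : ∀ x, 1 ≤ |x| → φ x = 0)
    (B : ℕ+) (x₀ : ℝ) {h : ℝ} (hh : 0 < h) (hBh : 1 ≤ B * h) :
    ∑ b : Fin B, φ (((b : ℝ) / B - x₀) / h) ^ 2 ≤ 3 * (B * h) := by
  classical
  have hle : ∀ b : Fin B, φ (((b : ℝ) / B - x₀) / h) ^ 2
      ≤ if |(b : ℝ) / B - x₀| ≤ h then 1 else 0 := by
    intro b
    split_ifs with hb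
    · rw [sq_le_one_iff_abs_le_one]; exact hφ1 _
    · rw [hφ0 _ (by rw [abs_div, abs_of_pos hh, one_le_div hh]; exact (not_le.1 hb).le)]
      simp
  calc _ ≤ ∑ b : Fin B, (if |(b : ℝ) / B - x₀| ≤ h then (1 : ℝ) else 0) :=
        Finset.sum_le_sum fun b _ => hle b
    _ = ((Finset.univ.filter fun b : Fin B => |(b : ℝ) / B - x₀| ≤ h).card : ℝ) := by
        rw [Finset.sum_boole]
    _ ≤ 2 * (B * h) + 1 := card_gridPoints_le B x₀ hh.le
    _ ≤ 3 * (B * h) := by linarith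

/-- With `p`, `q` the two bump values and `l = 1/(1+t)`, the residual is `l p + (1 - l)(p - q)`. The
first part is small since `l² ≤ l`, the second since `p - q` is at most `Λ/(Bh)`. Beyond distance
`2h` both values vanish, because a bucket is no wider than `h`. -/
theorem bump_residual_sq_le {φ : ℝ → ℝ} (hφ1 : ∀ x, |φ x| ≤ 1) (hφ0 : ∀ x, 1 ≤ |x| → φ x = 0)
    {Λ : ℝ} (hΛ : 0 ≤ Λ) (hφΛ : ∀ x y, |φ x - φ y| ≤ Λ * |x - y|)
    {B x₀ h t : ℝ} (hB : 0 < B) (hh : 0 < h) (hBh : 1 ≤ B * h) (ht : 0 ≤ t)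
    (hBt : Λ ^ 2 * (1 + t) ≤ (B * h) ^ 2) {x y : ℝ} (hxy : |x - y| ≤ 1 / B) :
    (φ ((x - x₀) / h) - t / (1 + t) * φ ((y - x₀) / h)) ^ 2
      ≤ (Metric.closedBall x₀ (2 * h)).indicator (fun _ => 4 / (1 + t)) x := by
  have hBh' : 1 / B ≤ h := by rw [div_le_iff₀ hB]; linarith
  by_cases hx : x ∈ Metric.closedBall x₀ (2 * h)
  · rw [indicator_of_mem hx]
    set p := φ ((x - x₀) / h)
    set q := φ ((y - x₀) / h)
    have hp : |p| ≤ 1 := hφ1 _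
    have hpq : |p - q| ≤ Λ / (B * h) := by
      refine (hφΛ _ _).trans ?_
      rw [← sub_div, sub_sub_sub_cancel_right, abs_div, abs_of_pos hh]
      calc Λ * (|x - y| / h) ≤ Λ * (1 / B / h) := by gcongr
        _ = Λ / (B * h) := by field_simp
    have hp2 : p ^ 2 ≤ 1 := (sq_le_one_iff_abs_le_one _).2 hp
    have hpq2 : (p - q) ^ 2 ≤ 1 / (1 + t) := by
      calc (p - q) ^ 2 = |p - q| ^ 2 := (sq_abs _).symm
        _ ≤ (Λ / (B * h)) ^ 2 := by gcongr
        _ ≤ 1 / (1 + t) := by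
          rw [div_pow, div_le_div_iff₀ (by positivity) (by positivity)]
          linarith
    have hl : 1 / (1 + t) ≤ 1 := by rw [div_le_one (by positivity)]; linarith
    have hl0 : 0 ≤ 1 / (1 + t) := by positivity
    have heq : p - t / (1 + t) * q = 1 / (1 + t) * p + t / (1 + t) * (p - q) := by
      field_simp; ring
    have hlt : t / (1 + t) = 1 - 1 / (1 + t) := by field_simp; ring
    have h4 : 4 / (1 + t) = 4 * (1 / (1 + t)) := by ring
    rw [heq, h4, hlt]
    set l := 1 / (1 + t)
    calc (l * p + (1 - l) * (p - q)) ^ 2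
        ≤ 2 * (l ^ 2 * p ^ 2) + 2 * ((1 - l) ^ 2 * (p - q) ^ 2) := by
          nlinarith [sq_nonneg (l * p - (1 - l) * (p - q))]
      _ ≤ 2 * (l * 1) + 2 * (1 * l) := by
          gcongr
          · nlinarith
          · nlinarith
      _ = 4 * l := by ring
  · rw [indicator_of_notMem hx]
    rw [Metric.mem_closedBall, Real.dist_eq, not_le] at hx
    have hy : h ≤ |y - x₀| := by
      have := abs_sub_abs_le_abs_sub (x - x₀) (x - y)
      rw [show x - x₀ - (x - y) = y - x₀ by ring] at this
      linarith
    rw [hφ0 _ (by rw [abs_div, abs_of_pos hh, one_le_div hh]; linarith),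
      hφ0 _ (by rw [abs_div, abs_of_pos hh, one_le_div hh]; exact hy)]
    simp

/-- On the ball, `exp w ≤ 1 + 2w`; the ball has length `4h`, whence the 8. Only an upper bound on
its mass is needed, so `x₀` may be near the boundary. -/
theorem lintegral_exp_le {w : ℝ → ℝ} {x₀ h M : ℝ} (hh : 0 ≤ h) (hM0 : 0 ≤ M) (hM1 : M ≤ 1)
    (hw0 : ∀ x, 0 ≤ w x)
    (hw : ∀ x ∈ Icc (0 : ℝ) 1, w x ≤ (Metric.closedBall x₀ (2 * h)).indicator (fun _ => M) x) :
    ∫⁻ x, ENNReal.ofReal (Real.exp (w x)) ∂covariateLaw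
      ≤ ENNReal.ofReal (Real.exp (8 * (M * h))) := by
  have hpt : ∀ x ∈ Icc (0 : ℝ) 1, ENNReal.ofReal (Real.exp (w x))
      ≤ 1 + (Metric.closedBall x₀ (2 * h)).indicator (fun _ => ENNReal.ofReal (2 * M)) x := by
    intro x hx
    have h1 := hw x hx
    by_cases hxb : x ∈ Metric.closedBall x₀ (2 * h)
    · rw [indicator_of_mem hxb] at h1 ⊢
      have h2 : |w x| ≤ 1 := by rw [abs_of_nonneg (hw0 x)]; linarith
      have h3 := (abs_le.1 (Real.abs_exp_sub_one_le h2)).2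
      rw [abs_of_nonneg (hw0 x)] at h3
      rw [← ENNReal.ofReal_one, ← ENNReal.ofReal_add zero_le_one (by positivity)]
      exact ENNReal.ofReal_le_ofReal (by linarith)
    · rw [indicator_of_notMem hxb] at h1 ⊢
      rw [le_antisymm h1 (hw0 x)]
      simp
  calc ∫⁻ x, ENNReal.ofReal (Real.exp (w x)) ∂covariateLaw
      ≤ ∫⁻ x, (1 + (Metric.closedBall x₀ (2 * h)).indicator
          (fun _ => ENNReal.ofReal (2 * M)) x) ∂covariateLaw :=
        setLIntegral_mono' measurableSet_Icc hpt
    _ = 1 + ENNReal.ofReal (2 * M) * covariateLaw (Metric.closedBall x₀ (2 * h)) := by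
        rw [lintegral_add_left measurable_const, lintegral_const, measure_univ, one_mul,
          lintegral_indicator_const Metric.isClosed_closedBall.measurableSet]
    _ ≤ 1 + ENNReal.ofReal (2 * M) * ENNReal.ofReal (4 * h) := by
        gcongr
        refine (Measure.restrict_apply_le _ _).trans ?_
        rw [Real.volume_closedBall]
        exact ENNReal.ofReal_le_ofReal (by linarith)
    _ = ENNReal.ofReal (8 * (M * h) + 1) := by
        rw [← ENNReal.ofReal_mul (by positivity), ← ENNReal.ofReal_one,
          ← ENNReal.ofReal_add zero_le_one (by positivity)]
        congr 1; ring
    _ ≤ _ := ENNReal.ofReal_le_ofReal (Real.add_one_le_exp _)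

theorem exp_sum_mul_lintegral_pow_le {φ : ℝ → ℝ} (hφ1 : ∀ x, |φ x| ≤ 1)
    (hφ0 : ∀ x, 1 ≤ |x| → φ x = 0) {Λ : ℝ} (hΛ : 0 ≤ Λ)
    (hφΛ : ∀ x y, |φ x - φ y| ≤ Λ * |x - y|)
    {σ δ : ℝ≥0} (hσ : 0 < σ) {B : ℕ+} {n : ℕ} {x₀ h q a t : ℝ} (ht : t = n * strength δ B)
    (hh : 0 < h) (hq0 : 0 ≤ q) (hq1 : q ≤ 1) (ha : 0 ≤ a) (haσ : a ≤ σ / 8)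
    (hBh : 1 ≤ B * h) (hBt : Λ ^ 2 * (1 + t) ≤ (B * h) ^ 2)
    (hN : effSampleSize n (strength δ B) * (h * q ^ 2) = 1) :
    ENNReal.ofReal (Real.exp (∑ b : Fin B,
        (t / (1 + t) * (a * q * φ (((b : ℝ) / B - x₀) / h))) ^ 2 / ((δ : ℝ) ^ 2 * (σ : ℝ) ^ 2))) *
      (∫⁻ x, ENNReal.ofReal (Real.exp ((a * q * φ ((x - x₀) / h) -
        t / (1 + t) * (a * q * φ (((bucket B x : ℝ) / B - x₀) / h))) ^ 2 / (σ : ℝ) ^ 2))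
          ∂covariateLaw) ^ n ≤ 2 := by
  have hB : (0 : ℝ) < B := by exact_mod_cast B.pos
  have hσ' : (0 : ℝ) < σ := by exact_mod_cast hσ
  have ht0 : 0 ≤ t := by rw [ht]; exact mul_nonneg (Nat.cast_nonneg _) (strength_nonneg δ B)
  have hN' : (n : ℝ) / (1 + t) * (h * q ^ 2) = 1 := by rw [ht]; exact hN
  have haσ2 : a ^ 2 / (σ : ℝ) ^ 2 ≤ 1 / 64 := by
    rw [div_le_div_iff₀ (by positivity) (by norm_num)]
    nlinarith
  have hsum : ∑ b : Fin B, (t / (1 + t) * (a * q * φ (((b : ℝ) / B - x₀) / h))) ^ 2 /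
      ((δ : ℝ) ^ 2 * (σ : ℝ) ^ 2) ≤ 3 * (a ^ 2 / (σ : ℝ) ^ 2) := by
    -- Drop one factor `t/(1+t) ≤ 1` and use `t ≤ nδ²/B`. For `δ = 0` the left side is 0 by
    -- convention.
    have hlam : (t / (1 + t)) ^ 2 / (δ : ℝ) ^ 2 ≤ n / (1 + t) / B := by
      rcases eq_or_ne δ 0 with rfl | hδ
      · simp only [NNReal.coe_zero, ne_eq, OfNat.ofNat_ne_zero, not_false_eq_true, zero_pow,
          div_zero]
        positivity
      · have hδ' : (0 : ℝ) < (δ : ℝ) := by exact_mod_cast pos_iff_ne_zero.2 hδ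
        rw [div_le_iff₀ (by positivity)]
        have h1 : t / (1 + t) ≤ 1 := by rw [div_le_one (by positivity)]; linarith
        have h0 : 0 ≤ t / (1 + t) := by positivity
        have htle : t ≤ n * ((δ : ℝ) ^ 2 / B) := by
          rw [ht]
          gcongr
          exact strength_le δ B
        calc (t / (1 + t)) ^ 2 ≤ t / (1 + t) := by nlinarith
          _ ≤ n * ((δ : ℝ) ^ 2 / B) / (1 + t) := by gcongr
          _ = n / (1 + t) / B * (δ : ℝ) ^ 2 := by ring
    calc _ = (t / (1 + t)) ^ 2 / (δ : ℝ) ^ 2 * (a ^ 2 * q ^ 2 / (σ : ℝ) ^ 2) *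
          ∑ b : Fin B, φ (((b : ℝ) / B - x₀) / h) ^ 2 := by
          rw [Finset.mul_sum]
          refine Finset.sum_congr rfl fun b _ => ?_
          rw [mul_pow, mul_pow, mul_pow, ← div_mul_div_comm]
          ring
      _ ≤ n / (1 + t) / B * (a ^ 2 * q ^ 2 / (σ : ℝ) ^ 2) * (3 * (B * h)) := by
          gcongr
          exact sum_bump_sq_le hφ1 hφ0 B x₀ hh hBh
      _ = 3 * (a ^ 2 / (σ : ℝ) ^ 2) * (n / (1 + t) * (h * q ^ 2)) := by
          field_simp
      _ = _ := by rw [hN', mul_one]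
  set M := a ^ 2 * q ^ 2 / (σ : ℝ) ^ 2 * (4 / (1 + t)) with hM
  have hM0 : 0 ≤ M := by positivity
  have hM1 : M ≤ 1 := by
    have h1 : 4 / (1 + t) ≤ 4 := by
      rw [div_le_iff₀ (by positivity)]; linarith
    have h2 : q ^ 2 ≤ 1 := pow_le_one₀ hq0 hq1
    calc M = a ^ 2 / (σ : ℝ) ^ 2 * q ^ 2 * (4 / (1 + t)) := by rw [hM]; ring
      _ ≤ 1 / 64 * 1 * 4 := by gcongr
      _ ≤ 1 := by norm_num
  have hint : ∫⁻ x, ENNReal.ofReal (Real.exp ((a * q * φ ((x - x₀) / h) -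
        t / (1 + t) * (a * q * φ (((bucket B x : ℝ) / B - x₀) / h))) ^ 2 / (σ : ℝ) ^ 2))
          ∂covariateLaw ≤ ENNReal.ofReal (Real.exp (8 * (M * h))) := by
    refine lintegral_exp_le (x₀ := x₀) hh.le hM0 hM1 (fun x => by positivity) fun x hx => ?_
    have h1 := bump_residual_sq_le hφ1 hφ0 hΛ hφΛ (x₀ := x₀) hB hh hBh ht0 hBt
      (abs_sub_bucket_le (B := B) hx)
    calc _ = a ^ 2 * q ^ 2 / (σ : ℝ) ^ 2 * (φ ((x - x₀) / h) -
          t / (1 + t) * φ (((bucket B x : ℝ) / B - x₀) / h)) ^ 2 := by ring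
      _ ≤ a ^ 2 * q ^ 2 / (σ : ℝ) ^ 2 *
          (Metric.closedBall x₀ (2 * h)).indicator (fun _ => 4 / (1 + t)) x := by gcongr
      _ = _ := by rw [hM, ← indicator_const_mul]
  calc _ ≤ ENNReal.ofReal (Real.exp (3 * (a ^ 2 / (σ : ℝ) ^ 2))) *
        ENNReal.ofReal (Real.exp (8 * (M * h))) ^ n := by gcongr
    _ = ENNReal.ofReal (Real.exp (35 * (a ^ 2 / (σ : ℝ) ^ 2))) := by
        rw [← ENNReal.ofReal_pow (by positivity), ← ENNReal.ofReal_mul (by positivity),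
          ← Real.exp_nat_mul, ← Real.exp_add]
        congr 2
        have : (n : ℝ) * (8 * (M * h))
            = 32 * (a ^ 2 / (σ : ℝ) ^ 2) * (n / (1 + t) * (h * q ^ 2)) := by rw [hM]; ring
        rw [this, hN']
        ring
    _ ≤ ENNReal.ofReal 2 := by
        refine ENNReal.ofReal_le_ofReal ?_
        -- The exponent is `3 + 32 = 35` times `a²/σ² ≤ 1/64`, and `35/64 < log 2`; hence the
        -- requirement `a ≤ σ/8`.
        rw [← Real.le_log_iff_exp_le (by norm_num)]
        linarith [Real.log_two_gt_d9]
    _ = 2 := by simp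

/-! ### From two points to the minimax risk, and the choice of bandwidth -/

/-- The two risks add up to at least `a²/4`, so their supremum is at least `a²/8`. The parameter `q`
stands for `h^β`. -/
theorem le_minimaxScaledRisk {β L : ℝ} (hL : 0 < L) {φ : ℝ → ℝ} (hφc : Continuous φ)
    (hφ00 : φ 0 = 1) (hφ1 : ∀ x, |φ x| ≤ 1)
    (hφ0 : ∀ x, 1 ≤ |x| → φ x = 0) {Λ : ℝ} (hΛ : 0 ≤ Λ)
    (hφΛ : ∀ x y, |φ x - φ y| ≤ Λ * |x - y|)
    {σ δ : ℝ≥0} (hσ : 0 < σ) {B : ℕ+} {n : ℕ} {x₀ h q a : ℝ}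
    (hh : 0 < h) (hq0 : 0 ≤ q) (hq1 : q ≤ 1) (ha : 0 ≤ a) (haσ : a ≤ σ / 8)
    (hmem : (fun x => a * q * φ ((x - x₀) / h)) ∈ holderClass β L)
    (hBh : 1 ≤ B * h) (hBt : Λ ^ 2 * (1 + n * strength δ B) ≤ (B * h) ^ 2)
    (hN : effSampleSize n (strength δ B) * (h * q ^ 2) = 1)
    (hr : effSampleSize n (strength δ B) ^ (2 * β / (2 * β + 1)) * q ^ 2 = 1) :
    ENNReal.ofReal (a ^ 2 / 8) ≤ minimaxScaledRisk β L σ δ B x₀ n := by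
  refine le_iInf fun g => ?_
  have hN0 : 0 ≤ effSampleSize n (strength δ B) := by
    have := strength_nonneg δ B
    unfold effSampleSize
    positivity
  set f : ℝ → ℝ := fun x => a * q * φ ((x - x₀) / h) with hf
  have hfm : Measurable f := by
    have : Continuous f := by fun_prop
    exact this.measurable
  set t : ℝ := n * strength δ B with ht
  have h2 := two_point_bound (δ := δ) (B := B) (x₀ := x₀) hσ n (Real.rpow_nonneg hN0
    (2 * β / (2 * β + 1))) g.2 hfm (m := fun b => t / (1 + t) * f ((b : ℝ) / B))
    (fun hδ => by ext b; simp [ht, hδ, strength])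
    (exp_sum_mul_lintegral_pow_le hφ1 hφ0 hΛ hφΛ hσ ht hh hq0 hq1 ha haσ hBh hBt hN)
  have hfx : f x₀ = a * q := by simp [hf, hφ00]
  rw [hfx, show effSampleSize n (strength δ B) ^ (2 * β / (2 * β + 1)) * (a * q) ^ 2 / 2
    = a ^ 2 / 2 by linear_combination a ^ 2 / 2 * hr] at h2
  set S := ⨆ f ∈ holderClass β L, scaledRisk σ δ B n
    (effSampleSize n (strength δ B) ^ (2 * β / (2 * β + 1))) x₀ g.1 f with hS
  have hS0 := le_iSup₂ (f := fun f (_ : f ∈ holderClass β L) => scaledRisk σ δ B n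
    (effSampleSize n (strength δ B) ^ (2 * β / (2 * β + 1))) x₀ g.1 f) _
    (zero_mem_holderClass (β := β) hL)
  have hS1 := le_iSup₂ (f := fun f (_ : f ∈ holderClass β L) => scaledRisk σ δ B n
    (effSampleSize n (strength δ B) ^ (2 * β / (2 * β + 1))) x₀ g.1 f) _ hmem
  have h3 : ENNReal.ofReal (a ^ 2 / 2) / 2 ≤ S * 2 := by
    rw [mul_two]
    exact h2.trans (add_le_add hS0 hS1)
  have h4 : ENNReal.ofReal (a ^ 2 / 8) = ENNReal.ofReal (a ^ 2 / 2) / 2 / 2 := by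
    rw [← ENNReal.ofReal_ofNat 2, ← ENNReal.ofReal_div_of_pos (by norm_num),
      ← ENNReal.ofReal_div_of_pos (by norm_num)]
    congr 1; ring
  rw [h4]
  exact ENNReal.div_le_of_le_mul h3

end RUP

theorem mainTheorem1 (β L : ℝ) (hβ : 0 < β) (hL : 0 < L) (σ : ℝ≥0) (hσ : 0 < σ) :
    ∃ c₁ : ℝ, 0 < c₁ ∧
      ∀ (x₀ : ℝ), x₀ ∈ Set.Icc (0 : ℝ) 1 →
      ∀ (B : ℕ → ℕ+) (δ : ℕ → ℝ≥0),
        (∃ C : ℝ, ∀ n : ℕ, (n : ℝ) / (B n : ℝ) ≤ C) →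
        (∃ C : ℝ, ∀ n : ℕ, (n : ℝ) * RUP.strength (δ n) (B n) ≤ C) →
        ENNReal.ofReal c₁ ≤
          Filter.liminf (fun n : ℕ => RUP.minimaxScaledRisk β L σ (δ n) (B n) x₀ n)
            Filter.atTop := by
  obtain ⟨φ, K, Λ, hK, hΛ, hφc, hφ00, hφ1, hφ0, hφΛ, hmem⟩ := RUP.exists_holder_bump hβ
  have hσ' : (0 : ℝ) < σ := by exact_mod_cast hσ
  obtain ⟨a, ha, haK, haσ⟩ : ∃ a : ℝ, 0 < a ∧ a * K ≤ L ∧ a ≤ σ / 8 :=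
    ⟨min (L / K) (σ / 8), by positivity, by rw [← le_div_iff₀ hK]; exact min_le_left _ _,
      min_le_right _ _⟩
  -- The constant is fixed before `C₁` and `C₂` appear; they only affect how large `n` must be.
  refine ⟨a ^ 2 / 8, by positivity, fun x₀ _ B δ ⟨C₁, hC₁⟩ ⟨C₂, hC₂⟩ => ?_⟩
  set D : ℝ := 1 + C₂ with hD
  set E : ℝ := max C₁ 1 with hE
  have hE0 : 0 < E := lt_max_of_lt_right one_pos
  have hD0 : 1 ≤ D := by
    have := hC₂ 0
    simp only [Nat.cast_zero, zero_mul] at this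
    linarith
  have h2β : 0 < 2 * β + 1 := by linarith
  have hNge : ∀ n : ℕ, (n : ℝ) / D ≤ RUP.effSampleSize n (RUP.strength (δ n) (B n)) := by
    intro n
    have h0 := mul_nonneg (Nat.cast_nonneg (α := ℝ) n) (RUP.strength_nonneg (δ n) (B n))
    unfold RUP.effSampleSize
    gcongr
    linarith [hC₂ n]
  have htend : Tendsto (fun n : ℕ => RUP.effSampleSize n (RUP.strength (δ n) (B n))) atTop atTop :=
    tendsto_atTop_mono hNge (tendsto_natCast_atTop_atTop.atTop_div_const (by linarith))
  have htend2 := (tendsto_rpow_atTop (y := 2 * β / (2 * β + 1)) (by positivity)).comp htend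
  refine le_liminf_of_le (by isBoundedDefault) ?_
  -- The first threshold gives `h ≤ 1`. Since `N h = N^(2β/(2β+1))` and `N ≤ n ≤ E B`, the second
  -- forces `B h ≥ 1 + Λ² D`, which yields both conditions on `B h`.
  filter_upwards [htend.eventually_ge_atTop 1,
    htend2.eventually_ge_atTop (E * (1 + Λ ^ 2 * D))] with n hn1 hn2
  have hB : (0 : ℝ) < B n := by exact_mod_cast (B n).pos
  have ht0 := mul_nonneg (Nat.cast_nonneg (α := ℝ) n) (RUP.strength_nonneg (δ n) (B n))
  have hNle : RUP.effSampleSize n (RUP.strength (δ n) (B n)) ≤ n :=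
    div_le_self (Nat.cast_nonneg _) (by linarith)
  simp only [Function.comp_apply] at hn2
  set N := RUP.effSampleSize n (RUP.strength (δ n) (B n)) with hN
  have hN0 : 0 < N := by linarith
  set h : ℝ := N ^ (-(1 / (2 * β + 1))) with hh
  have hh0 : 0 < h := Real.rpow_pos_of_pos hN0 _
  have hh1 : h ≤ 1 := Real.rpow_le_one_of_one_le_of_nonpos hn1 (by
    rw [neg_nonpos]; positivity)
  have hq2 : (h ^ β) ^ 2 = N ^ (-(2 * β / (2 * β + 1))) := by
    rw [hh, ← Real.rpow_mul hN0.le, ← Real.rpow_natCast, ← Real.rpow_mul hN0.le]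
    congr 1; push_cast; ring
  have hNh : N * h = N ^ (2 * β / (2 * β + 1)) := by
    rw [hh]
    nth_rewrite 1 [← Real.rpow_one N]
    rw [← Real.rpow_add hN0]
    congr 1; field_simp; ring
  have hBh : 1 + Λ ^ 2 * D ≤ B n * h := by
    have h1 : N ≤ E * B n := by
      have := (div_le_iff₀ hB).1 ((hC₁ n).trans (le_max_left C₁ 1))
      linarith
    have h2 : E * (1 + Λ ^ 2 * D) ≤ E * (B n * h) := by
      calc _ ≤ N * h := by rw [hNh]; exact hn2
        _ ≤ E * B n * h := by gcongr
        _ = _ := by ring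
    exact le_of_mul_le_mul_left h2 hE0
  have hΛD : 0 ≤ Λ ^ 2 * D := by positivity
  have hr : N ^ (2 * β / (2 * β + 1)) * (h ^ β) ^ 2 = 1 := by
    rw [hq2, ← Real.rpow_add hN0, add_neg_cancel, Real.rpow_zero]
  refine RUP.le_minimaxScaledRisk hL hφc hφ00 hφ1 hφ0 hΛ hφΛ hσ hh0 (q := h ^ β)
    (Real.rpow_nonneg hh0.le _) (Real.rpow_le_one hh0.le hh1 hβ.le) ha.le haσ
    (hmem L x₀ h a hh0 ha.le haK) (by linarith) ?_ ?_ hr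
  · calc Λ ^ 2 * (1 + n * RUP.strength (δ n) (B n)) ≤ Λ ^ 2 * D := by
          gcongr; linarith [hC₂ n]
      _ ≤ (B n * h) ^ 2 := by nlinarith
  · rw [← hN, ← mul_assoc, hNh, hr]
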